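/- **Theorem 4.5.** Let $\lambda$ denote regular cardinals. A *$\lambda$-directed colimit* is a colimit of a diagram indexed by a small poset in which every subset of cardinality $<\lambda$ has an upper bound; a *directed colimit* is an $\aleph_0$-directed colimit. An object $K$ of a category $\mathcal K$ with small hom-sets is *$\lambda$-presentable* if $\hom(K,-)$ preserves $\lambda$-directed colimits. Such a category $\mathcal K$ is *$\lambda$-accessible* if it has $\lambda$-directed colimits and a set $\mathcal A$ of $\lambda$-presentable objects such that every object of $\mathcal K$ is a $\lambda$-directed colimit of objects from $\mathcal A$. It is *accessible* if it is $\lambda$-accessible for some regular cardinal $\lambda$, and *finitely accessible* if it is $\aleph_0$-accessible. A full subcategory $\mathcal P$ of a category $\mathcal L$ is *accessibly embedded* if there is a regular cardinal $\lambda$ such that $\mathcal P$ is closed under $\lambda$-directed colimits in $\mathcal L$ (every colimit in $\mathcal L$ of a $\lambda$-directed diagram of objects of $\mathcal P$ lies in $\mathcal P$), and *reflective* if the inclusion $\mathcal P\hookrightarrow\mathcal L$ has a left adjoint. Up to equivalence of categories, the accessible categories with directed colimits are precisely the reflective, accessibly embedded full subcategories of finitely accessible categories. That is: 1. every accessible category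 that has all directed colimits is equivalent to a reflective, accessibly embedded full subcategory of some finitely accessible category; 2. every reflective, accessibly embedded full subcategory of a finitely accessible category is accessible and has all directed colimits. -/

import Mathlib

open CategoryTheory CategoryTheory.Limits

universe w v v' u u'

/-- `C` has directed colimits: every diagram in `C` indexed by a (`w`-small, nonempty)
directed poset has a colimit. -/
def HasDirectedColimits (C : Type u) [Category.{v} C] : Prop :=
  ∀ (J : Type w) [PartialOrder J] [IsDirectedOrder J] [Nonempty J], HasColimitsOfShape J C

/-- A full subcategory of `L`, given by a property `P` of objects, is accessibly embedded if for
some regular cardinal `κ` it is closed in `L` under colimits of diagrams indexed by (`w`-small)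
`κ`-directed posets. For a poset `J`, `IsCardinalFiltered J κ` says that every subset of `J` of
cardinality `< κ` has an upper bound. Closure is understood up to isomorphism: every colimit
object in `L` of such a diagram of objects of `P` satisfies `P`. -/
def IsAccessiblyEmbedded {L : Type u} [Category.{v} L] (P : ObjectProperty L) : Prop :=
  ∃ (κ : Cardinal.{w}) (_ : Fact κ.IsRegular),
    ∀ (J : Type w) [PartialOrder J] [IsCardinalFiltered J κ], P.IsClosedUnderColimitsOfShape J

/-! For `C` κ-accessible with directed colimits, let `A` be a small dense full subcategory of
κ-presentable objects. Restricted Yoneda embeds `C` fully into `Ind A` and preserves κ-filtered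
colimits, so its essential image is accessibly embedded (`isAccessiblyEmbedded_essImage_toInd`).
Every ind-object is a filtered colimit of representables, which lie in the image; reflecting it
means taking the same colimit in `C` (`isRightAdjoint_toInd`).

Conversely, a finitely accessible category is κ-accessible for every uncountable regular κ, since a
directed poset is the κ-directed union of its directed subsets of size < κ. For suitable κ the
inclusion of the subcategory preserves κ-filtered colimits, so the reflector carries a κ-presentable
generator to one of the subcategory. -/

namespace Cardinal

attribute [local instance] fact_isRegular_aleph0

/-- A set of cardinality `< κ` in a directed poset is contained in a directed subset of
cardinality `< κ`, when `κ` is an uncountable regular cardinal. -/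
lemma exists_isCardinalFiltered_aleph0_set {κ : Cardinal.{w}} [Fact κ.IsRegular] (h : aleph0 < κ)
    {X : Type w} [PartialOrder X] [IsCardinalFiltered X aleph0.{w}] (A : Set X)
    (hA : HasCardinalLT A κ) :
    ∃ (B : Set X), A ⊆ B ∧ IsCardinalFiltered B aleph0.{w} ∧ HasCardinalLT B κ := by
  refine SharplyLT.exists_isCardinalFiltered_set_of_exists_cofinal h (fun Y hY ↦ ?_) A hA
  -- No smaller cofinal family is needed: a set of size < κ has fewer than κ finite subsets, as κ is
  -- uncountable.
  refine ⟨Set.univ, ?_, fun S ↦ ⟨S, Set.mem_univ _, le_rfl⟩⟩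
  have hF : HasCardinalLT (Finset Y) κ := by
    rw [hasCardinalLT_iff_cardinal_mk_lt] at hY ⊢
    rcases finite_or_infinite Y with hfin | hinf
    · exact (Cardinal.lt_aleph0_of_finite _).trans h
    · rwa [Cardinal.mk_finset_of_infinite]
  refine hF.of_surjective (fun s ↦ ⟨⟨s, by
      rw [hasCardinalLT_aleph0_iff]
      exact s.finite_toSet.to_subtype⟩, Set.mem_univ _⟩) ?_
  rintro ⟨⟨S, hS⟩, -⟩
  rw [hasCardinalLT_aleph0_iff] at hS
  exact ⟨(Set.toFinite S).toFinset, by simp⟩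

end Cardinal

namespace CategoryTheory

/-! ### Rewriting a directed colimit as a colimit over small directed subsets -/

section DirectedSubsets

variable {α : Type w} [PartialOrder α] (κ κ' : Cardinal.{w}) [Fact κ.IsRegular]

/-- The `κ`-directed subsets of cardinality `< κ'` of a partially ordered type. -/
abbrev DirectedSubsets (α : Type w) [PartialOrder α] : Type w :=
  { B : Set α // IsCardinalFiltered B κ ∧ HasCardinalLT B κ' }

namespace DirectedSubsets

variable {κ κ'}
variable {C : Type u} [Category.{v} C] [HasCardinalFilteredColimits C κ] (F : α ⥤ C)

/-- The restriction of a functor from a poset to a subset. -/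
abbrev restrict (B : Set α) : B ⥤ C :=
  (Subtype.mono_coe (· ∈ B)).functor ⋙ F

instance (B : DirectedSubsets κ κ' α) : HasColimit (restrict F B.1) := by
  have := B.2.1
  have := HasCardinalFilteredColimits.hasColimitsOfShape C κ B.1
  infer_instance

/-- The colimit of the restriction of a functor to a small directed subset. -/
noncomputable def colimitObj (B : DirectedSubsets κ κ' α) : C := colimit (restrict F B.1)

/-- The canonical map to `colimitObj F B` for an element of `B`. -/
noncomputable def ιColimitObj (B : DirectedSubsets κ κ' α) {a : α} (ha : a ∈ B.1) :
    F.obj a ⟶ colimitObj F B :=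
  colimit.ι (restrict F B.1) ⟨a, ha⟩

lemma map_ιColimitObj (B : DirectedSubsets κ κ' α) {a b : α} (f : a ⟶ b) (ha : a ∈ B.1)
    (hb : b ∈ B.1) : F.map f ≫ ιColimitObj F B hb = ιColimitObj F B ha :=
  colimit.w (restrict F B.1)
    (show (⟨a, ha⟩ : B.1) ⟶ ⟨b, hb⟩ from homOfLE (show a ≤ b from leOfHom f))

variable {F} in
lemma colimitObj_hom_ext {B : DirectedSubsets κ κ' α} {X : C} {f g : colimitObj F B ⟶ X}
    (h : ∀ (a : α) (ha : a ∈ B.1), ιColimitObj F B ha ≫ f = ιColimitObj F B ha ≫ g) : f = g :=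
  colimit.hom_ext (F := restrict F B.1) (fun b ↦ h b.1 b.2)

/-- Constructor for morphisms from `colimitObj F B`. -/
noncomputable def descColimitObj (B : DirectedSubsets κ κ' α) {X : C}
    (φ : ∀ (a : α), a ∈ B.1 → (F.obj a ⟶ X))
    (hφ : ∀ (a b : α) (f : a ⟶ b) (ha : a ∈ B.1) (hb : b ∈ B.1), F.map f ≫ φ b hb = φ a ha) :
    colimitObj F B ⟶ X :=
  colimit.desc (restrict F B.1)
    { pt := X
      ι :=
        { app b := φ b.1 b.2
          naturality b b' f :=
            (hφ b.1 b'.1 (homOfLE (leOfHom f)) b.2 b'.2).trans (Category.comp_id _).symm } }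

lemma ι_descColimitObj (B : DirectedSubsets κ κ' α) {X : C}
    (φ : ∀ (a : α), a ∈ B.1 → (F.obj a ⟶ X))
    (hφ : ∀ (a b : α) (f : a ⟶ b) (ha : a ∈ B.1) (hb : b ∈ B.1), F.map f ≫ φ b hb = φ a ha)
    {a : α} (ha : a ∈ B.1) :
    ιColimitObj F B ha ≫ descColimitObj F B φ hφ = φ a ha :=
  colimit.ι_desc (F := restrict F B.1) _ _

lemma ι_descColimitObj_assoc (B : DirectedSubsets κ κ' α) {X Y : C}
    (φ : ∀ (a : α), a ∈ B.1 → (F.obj a ⟶ X))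
    (hφ : ∀ (a b : α) (f : a ⟶ b) (ha : a ∈ B.1) (hb : b ∈ B.1), F.map f ≫ φ b hb = φ a ha)
    {a : α} (ha : a ∈ B.1) (g : X ⟶ Y) :
    ιColimitObj F B ha ≫ descColimitObj F B φ hφ ≫ g = φ a ha ≫ g := by
  rw [← Category.assoc, ι_descColimitObj]

variable (κ κ') in
/-- The functor sending a small directed subset to the colimit of the restriction. -/
noncomputable def colimitFunctor : DirectedSubsets κ κ' α ⥤ C where
  obj B := colimitObj F B
  map {B B'} f := descColimitObj F B (fun _ ha ↦ ιColimitObj F B' (leOfHom f ha))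
    (fun _ _ g _ _ ↦ map_ιColimitObj F B' g _ _)
  map_id B := colimitObj_hom_ext (fun a ha ↦ by simp [ι_descColimitObj])
  map_comp f g := colimitObj_hom_ext
    (fun a ha ↦ by simp [ι_descColimitObj, ι_descColimitObj_assoc])

/-- The canonical map to `(colimitFunctor κ κ' F).obj B` for an element of `B`. -/
noncomputable def ιColimitFunctor (B : DirectedSubsets κ κ' α) {a : α} (ha : a ∈ B.1) :
    F.obj a ⟶ (colimitFunctor κ κ' F).obj B :=
  ιColimitObj F B ha

lemma ι_colimitFunctor_map {B B' : DirectedSubsets κ κ' α} (f : B ⟶ B') {a : α} (ha : a ∈ B.1) :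
    ιColimitFunctor F B ha ≫ (colimitFunctor κ κ' F).map f =
      ιColimitFunctor F B' (leOfHom f ha) :=
  ι_descColimitObj F B (fun _ ha ↦ ιColimitObj F B' (leOfHom f ha))
    (fun _ _ g _ _ ↦ map_ιColimitObj F B' g _ _) ha

variable {F}

variable (κ κ') in
/-- The cocone induced on `colimitFunctor κ κ' F` by a cocone for `F`. -/
noncomputable def colimitCocone (c : Cocone F) : Cocone (colimitFunctor κ κ' F) where
  pt := c.pt
  ι :=
    { app B := descColimitObj F B (fun a _ ↦ c.ι.app a) (fun _ _ f _ _ ↦ c.w f)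
      naturality B B' f := colimitObj_hom_ext (fun a ha ↦ by
        simp [colimitFunctor, ι_descColimitObj, ι_descColimitObj_assoc]) }

lemma ι_colimitCocone_ι_app (c : Cocone F) (B : DirectedSubsets κ κ' α) {a : α} (ha : a ∈ B.1) :
    ιColimitFunctor F B ha ≫ (colimitCocone κ κ' c).ι.app B = c.ι.app a :=
  ι_descColimitObj F B (fun a _ ↦ c.ι.app a) (fun _ _ f _ _ ↦ c.w f) ha

lemma ι_colimitCocone_ι_app_comp (c : Cocone F) (B : DirectedSubsets κ κ' α) {a : α}
    (ha : a ∈ B.1) {X : C} (m : (colimitCocone κ κ' c).pt ⟶ X) :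
    ιColimitFunctor F B ha ≫ (colimitCocone κ κ' c).ι.app B ≫ m =
      c.ι.app a ≫ (show c.pt ⟶ X from m) :=
  (Category.assoc _ _ _).symm.trans
    (congrArg (fun (f : F.obj a ⟶ c.pt) ↦ f ≫ (show c.pt ⟶ X from m))
      (ι_colimitCocone_ι_app c B ha))

variable [Fact κ'.IsRegular]
variable (hα : ∀ (A : Set α), HasCardinalLT A κ' →
    ∃ (B : Set α), A ⊆ B ∧ IsCardinalFiltered B κ ∧ HasCardinalLT B κ')

-- By regularity of κ', a union of fewer than κ' small subsets is small; `hα` then encloses it in a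
-- directed one.
include hα in
lemma isCardinalFiltered : IsCardinalFiltered (DirectedSubsets κ κ' α) κ' :=
  isCardinalFiltered_preorder _ _ (fun K f hK ↦ by
    obtain ⟨B, hB, h₁, h₂⟩ := hα (⋃ k, (f k).1) (hasCardinalLT_iUnion _
      (by rwa [hasCardinalLT_iff_cardinal_mk_lt]) (fun k ↦ (f k).2.2))
    exact ⟨⟨B, h₁, h₂⟩, fun k ↦ (Set.subset_iUnion (fun k ↦ (f k).1) k).trans hB⟩)

include hα in
lemma exists_mem (a : α) : ∃ (B : DirectedSubsets κ κ' α), a ∈ B.1 := by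
  obtain ⟨B, hB, h₁, h₂⟩ := hα {a}
    (hasCardinalLT_of_finite _ _ (Cardinal.IsRegular.aleph0_le Fact.out))
  exact ⟨⟨B, h₁, h₂⟩, hB rfl⟩

include hα in
lemma ι_app_eq (s : Cocone (colimitFunctor κ κ' F)) {a : α} {B B' : DirectedSubsets κ κ' α}
    (h : a ∈ B.1) (h' : a ∈ B'.1) :
    ιColimitFunctor F B h ≫ s.ι.app B = ιColimitFunctor F B' h' ≫ s.ι.app B' := by
  have := isCardinalFiltered hα
  have := isFiltered_of_isCardinalFiltered (DirectedSubsets κ κ' α) κ'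
  rw [← s.w (IsFiltered.leftToMax B B'), ← s.w (IsFiltered.rightToMax B B'),
    ← Category.assoc, ← Category.assoc,
    ι_colimitFunctor_map, ι_colimitFunctor_map]

/-- The cocone for `F` induced by a cocone for `colimitFunctor κ κ' F`. -/
noncomputable def coconeOfColimitFunctor (s : Cocone (colimitFunctor κ κ' F)) : Cocone F where
  pt := s.pt
  ι :=
    { app a := ιColimitFunctor F _ (exists_mem hα a).choose_spec ≫ s.ι.app _
      naturality a b f := by
        have := isCardinalFiltered hα
        have := isFiltered_of_isCardinalFiltered (DirectedSubsets κ κ' α) κ'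
        let B := IsFiltered.max (exists_mem hα a).choose (exists_mem hα b).choose
        have ha : a ∈ B.1 :=
          (show (exists_mem hα a).choose.1 ⊆ B.1 from
            leOfHom (IsFiltered.leftToMax (exists_mem hα a).choose (exists_mem hα b).choose))
            (exists_mem hα a).choose_spec
        have hb : b ∈ B.1 :=
          (show (exists_mem hα b).choose.1 ⊆ B.1 from
            leOfHom (IsFiltered.rightToMax (exists_mem hα a).choose (exists_mem hα b).choose))
            (exists_mem hα b).choose_spec
        have h : F.map f ≫ ιColimitFunctor F B hb = ιColimitFunctor F B ha :=
          map_ιColimitObj F B f ha hb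
        rw [ι_app_eq hα s _ ha, ι_app_eq hα s _ hb, ← Category.assoc, h]
        exact (Category.comp_id _).symm }

/-- A colimit indexed by a poset is the colimit of the colimits indexed by its
small directed subsets. -/
noncomputable def isColimitColimitCocone {c : Cocone F} (hc : IsColimit c) :
    IsColimit (colimitCocone κ κ' c) where
  desc s := hc.desc (coconeOfColimitFunctor hα s)
  fac s B := colimitObj_hom_ext (fun a ha ↦
    (ι_colimitCocone_ι_app_comp c B ha _).trans
      ((hc.fac (coconeOfColimitFunctor hα s) a).trans (ι_app_eq hα s _ _)))
  uniq s m hm := hc.hom_ext (fun a ↦ by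
    refine Eq.trans ?_ (hc.fac (coconeOfColimitFunctor hα s) a).symm
    refine (ι_colimitCocone_ι_app_comp c _ (exists_mem hα a).choose_spec m).symm.trans ?_
    rw [hm]
    rfl)

end DirectedSubsets

end DirectedSubsets

/-! ### Raising the index of accessibility -/

section

variable (C : Type u) [Category.{v} C]

lemma IsCardinalAccessibleCategory.of_exists_directed_set
    (κ κ' : Cardinal.{w}) [Fact κ.IsRegular] [Fact κ'.IsRegular] (h : κ ≤ κ')
    [IsCardinalAccessibleCategory C κ]
    (hκ : ∀ (α : Type w) [PartialOrder α] [IsCardinalFiltered α κ] (A : Set α),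
      HasCardinalLT A κ' →
        ∃ (B : Set α), A ⊆ B ∧ IsCardinalFiltered B κ ∧ HasCardinalLT B κ') :
    IsCardinalAccessibleCategory C κ' where
  hasColimitsOfShape J _ _ := by
    have := IsCardinalFiltered.of_le J h
    exact HasCardinalFilteredColimits.hasColimitsOfShape C κ J
  exists_generator := by
    -- The new generators are κ'-small colimits of κ-presentables, which include the colimits over
    -- small directed subsets.
    refine ⟨(isCardinalPresentable C κ).colimitsCardinalClosure κ', inferInstance, ?_, ?_⟩
    · exact ObjectProperty.colimitsCardinalClosure_le_isCardinalPresentable _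
        (isCardinalPresentable_monotone C h)
    · intro X
      obtain ⟨J, _, _, hX⟩ :=
        (isCardinalFilteredGenerator_isCardinalPresentable C κ).exists_colimitsOfShape X
      obtain ⟨α, _, _, F, _⟩ := IsCardinalFiltered.exists_cardinal_directed J κ
      obtain ⟨p⟩ := ObjectProperty.colimitsOfShape_le_of_final _ F _ hX
      have := DirectedSubsets.isCardinalFiltered (hκ α)
      refine ⟨DirectedSubsets κ κ' α, inferInstance, inferInstance, ⟨{
        diag := _
        ι := _
        isColimit := DirectedSubsets.isColimitColimitCocone (hκ α) p.isColimit
        prop_diag_obj B := ?_ }⟩⟩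
      have hB : HasCardinalLT (Arrow B.1) κ' := by
        have hκ' := Cardinal.IsRegular.aleph0_le (Fact.out : κ'.IsRegular)
        refine (hasCardinalLT_prod hκ' B.2.2 B.2.2).of_injective
          (fun f ↦ (f.left, f.right)) (fun f g hfg ↦ ?_)
        obtain ⟨f₁, f₂, f⟩ := f
        obtain ⟨g₁, g₂, g⟩ := g
        simp only [Prod.mk.injEq] at hfg
        obtain ⟨rfl, rfl⟩ := hfg
        obtain rfl : f = g := Subsingleton.elim _ _
        rfl
      have := (isCardinalPresentable C κ).isClosedUnderColimitsOfShape_colimitsCardinalClosure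
        κ' B.1 hB
      exact ObjectProperty.prop_colimit _ _ (fun b ↦
        ObjectProperty.le_colimitsCardinalClosure _ _ _ (p.prop_diag_obj b.1))

/-- A finitely accessible category is `κ`-accessible for any uncountable regular cardinal `κ`. -/
lemma IsFinitelyAccessibleCategory.isCardinalAccessibleCategory
    [IsFinitelyAccessibleCategory.{w} C] (κ : Cardinal.{w}) [Fact κ.IsRegular]
    (h : Cardinal.aleph0 < κ) : IsCardinalAccessibleCategory C κ :=
  have : Fact Cardinal.aleph0.{w}.IsRegular := Cardinal.fact_isRegular_aleph0
  IsCardinalAccessibleCategory.of_exists_directed_set C Cardinal.aleph0 κ h.le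
    (fun _ _ _ ↦ Cardinal.exists_isCardinalFiltered_aleph0_set h)

end

end CategoryTheory

namespace CategoryTheory

/-! ### Reflective accessibly embedded subcategories -/

section

variable {C : Type u} [Category.{v} C]

lemma HasDirectedColimits.hasColimitsOfShape (hC : HasDirectedColimits.{w} C) (J : Type w)
    [SmallCategory J] [IsFiltered J] : HasColimitsOfShape J C := by
  obtain ⟨α, _, _, _, F, _⟩ := IsFiltered.exists_directed J
  have := hC α
  exact Functor.Final.hasColimitsOfShape_of_final F

lemma HasDirectedColimits.of_hasFilteredColimits [HasFilteredColimitsOfSize.{w, w} C] :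
    HasDirectedColimits.{w} C :=
  fun J _ _ _ ↦ HasFilteredColimitsOfSize.HasColimitsOfShape J

lemma HasDirectedColimits.of_reflective {D : Type u'} [Category.{v'} D] (R : C ⥤ D) [Reflective R]
    (hD : HasDirectedColimits.{w} D) : HasDirectedColimits.{w} C :=
  fun J _ _ _ ↦
    have := hD J
    hasColimitsOfShape_of_reflective R

/-- Final functors from κ-directed posets extend the closure to all κ-filtered shapes. -/
lemma ObjectProperty.isCardinalAccessible_ι (P : ObjectProperty C) (κ : Cardinal.{w})
    [Fact κ.IsRegular] [HasCardinalFilteredColimits C κ]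
    (hP : ∀ (J : Type w) [PartialOrder J] [IsCardinalFiltered J κ],
      P.IsClosedUnderColimitsOfShape J) :
    P.ι.IsCardinalAccessible κ where
  preservesColimitOfShape J _ _ := by
    obtain ⟨α, _, _, F, _⟩ := IsCardinalFiltered.exists_cardinal_directed J κ
    have : P.IsClosedUnderColimitsOfShape J :=
      ⟨(P.colimitsOfShape_le_of_final F).trans (hP α).colimitsOfShape_le⟩
    have := HasCardinalFilteredColimits.hasColimitsOfShape C κ J
    infer_instance

end

section

variable {L : Type u} [Category.{v} L] (P : ObjectProperty L)

attribute [local instance] Cardinal.fact_isRegular_aleph0 in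
lemma IsFinitelyAccessibleCategory.isAccessibleCategory_fullSubcategory
    [IsFinitelyAccessibleCategory.{w} L] [Reflective P.ι] (hP : IsAccessiblyEmbedded.{w} P) :
    IsAccessibleCategory.{w} P.FullSubcategory := by
  obtain ⟨κ₀, _, hκ₀⟩ := hP
  have h₀ := Cardinal.IsRegular.aleph0_le (Fact.out : κ₀.IsRegular)
  -- The successor is used because κ₀ may be ℵ₀, while raising the index needs an uncountable
  -- cardinal.
  have : Fact (Order.succ κ₀).IsRegular := ⟨Cardinal.isRegular_succ h₀⟩
  have h := Order.lt_succ κ₀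
  have := IsFinitelyAccessibleCategory.isCardinalAccessibleCategory L _ (h₀.trans_lt h)
  have := P.isCardinalAccessible_ι (Order.succ κ₀) (fun J _ _ ↦
    have := IsCardinalFiltered.of_le J h.le
    hκ₀ J)
  exact ⟨_, inferInstance, (reflectorAdjunction P.ι).isCardinalAccessibleCategory (Order.succ κ₀)⟩

attribute [local instance] Cardinal.fact_isRegular_aleph0 in
lemma IsFinitelyAccessibleCategory.hasDirectedColimits [IsFinitelyAccessibleCategory.{w} L] :
    HasDirectedColimits.{w} L :=
  have := (HasCardinalFilteredColimits_iff_hasFilteredColimitsOfSize.{w} (C := L)).1 inferInstance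
  .of_hasFilteredColimits

end

/-! ### Left adjoints and essential images of fully faithful functors -/

namespace Functor

variable {C : Type u} [Category.{v} C] {D : Type u'} [Category.{v'} D] (G : C ⥤ D)

lemma leftAdjointObjIsDefined_of_essImage [G.Full] [G.Faithful] {Y : D} (hY : G.essImage Y) :
    G.leftAdjointObjIsDefined Y := by
  obtain ⟨X, ⟨e⟩⟩ := hY
  exact CorepresentableBy.isCorepresentable (X := X)
    { homEquiv := (FullyFaithful.ofFullyFaithful G).homEquiv.trans e.homFromEquiv
      homEquiv_comp g f := by simp [FullyFaithful.homEquiv] }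

/-- A fully faithful functor `G : C ⥤ D` has a left adjoint when any object of `D` is a colimit of
objects in the essential image of `G`, for a shape such that `C` has colimits of this shape. -/
lemma isRightAdjoint_of_essImage_colimitsOfShape [G.Full] [G.Faithful]
    (h : ∀ (Y : D), ∃ (J : Type w) (_ : SmallCategory J) (_ : HasColimitsOfShape J C),
      G.essImage.colimitsOfShape J Y) : G.IsRightAdjoint := by
  refine isRightAdjoint_of_leftAdjointObjIsDefined_eq_top (top_le_iff.1 (fun Y _ ↦ ?_))
  obtain ⟨J, _, _, ⟨p⟩⟩ := h Y
  -- Reflections of the diagram objects have a colimit in `C`, which is the reflection of `Y`.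
  exact leftAdjointObjIsDefined_of_isColimit p.isColimit
    (fun j ↦ G.leftAdjointObjIsDefined_of_essImage (p.prop_diag_obj j))

/-- The essential image of a fully faithful functor is closed under the colimits that
the functor preserves. -/
lemma isClosedUnderColimitsOfShape_essImage [G.Full] [G.Faithful] (J : Type*) [Category* J]
    [HasColimitsOfShape J C] [PreservesColimitsOfShape J G] :
    G.essImage.IsClosedUnderColimitsOfShape J where
  colimitsOfShape_le := fun _ ⟨p⟩ ↦
    ⟨colimit (essImage.liftFunctor p.diag G p.prop_diag_obj),
      ⟨(isColimitOfPreserves G (colimit.isColimit _)).coconePointsIsoOfNatIso p.isColimit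
        (essImage.liftFunctorCompIso p.diag G p.prop_diag_obj)⟩⟩

/-- A fully faithful right adjoint induces a reflective inclusion of its essential image. -/
lemma nonempty_reflective_ι_essImage [G.Full] [G.Faithful] [G.IsRightAdjoint] :
    Nonempty (Reflective G.essImage.ι) := by
  have := isRightAdjoint_of_iso (F := G.toEssImage.inv ⋙ G) (G := G.essImage.ι)
    (isoWhiskerLeft _ G.toEssImageCompι.symm ≪≫ (associator _ _ _).symm ≪≫
      isoWhiskerRight G.toEssImage.asEquivalence.counitIso _ ≪≫ leftUnitor _)
  exact ⟨{ L := _, adj := Adjunction.ofIsRightAdjoint G.essImage.ι }⟩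

end Functor

/-! ### Finite accessibility of ind-categories -/

section

variable {A : Type w} [SmallCategory A]

attribute [local instance] Cardinal.fact_isRegular_aleph0

namespace Ind

/-- Morphisms from a representable object in `Ind A` are given by evaluation. -/
noncomputable def coyonedaYonedaIso (a : A) :
    coyoneda.obj (Opposite.op (Ind.yoneda.obj a)) ≅
      Ind.inclusion A ⋙ (evaluation _ _).obj (Opposite.op a) :=
  NatIso.ofComponents (fun X ↦ (((Ind.inclusion.fullyFaithful (C := A)).homEquiv.trans
    ((Ind.yonedaCompInclusion (C := A)).app a).homFromEquiv).trans yonedaEquiv).toIso)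
    (fun f ↦ by
      ext g
      simp [yonedaEquiv, Functor.FullyFaithful.homEquiv])

instance isFinitelyPresentable_yoneda_obj (a : A) :
    IsFinitelyPresentable.{w} (Ind.yoneda.obj a) where
  preservesColimitOfShape J _ _ := by
    have := isFiltered_of_isCardinalFiltered J Cardinal.aleph0.{w}
    exact preservesColimitsOfShape_of_natIso (coyonedaYonedaIso a).symm

variable (A) in
lemma isCardinalFilteredGenerator_ofObj_yoneda :
    (ObjectProperty.ofObj (Ind.yoneda (C := A)).obj).IsCardinalFilteredGenerator
      Cardinal.aleph0.{w} where
  le_isCardinalPresentable := by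
    rintro _ ⟨a⟩
    exact isFinitelyPresentable_yoneda_obj a
  exists_colimitsOfShape X :=
    ⟨X.presentation.I, inferInstance, (isCardinalFiltered_aleph0_iff.{w} _).2 inferInstance,
      ⟨(ObjectProperty.ColimitOfShape.colimit _ (fun _ ↦ ⟨_⟩)).ofIso
        X.colimitPresentationCompYoneda⟩⟩

instance : IsFinitelyAccessibleCategory.{w} (Ind A) where
  toHasCardinalFilteredColimits :=
    HasCardinalFilteredColimits_iff_hasFilteredColimits.2 inferInstance
  toHasCardinalFilteredGenerator :=
    (isCardinalFilteredGenerator_ofObj_yoneda A).hasCardinalFilteredGenerator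

end Ind

end

end CategoryTheory

namespace CategoryTheory

/-! ### The embedding into ind-objects by restricted Yoneda -/

namespace Functor

variable {C : Type u} [Category.{w} C] {A : Type w} [SmallCategory A] (F : A ⥤ C)

/-- For a fully faithful functor `F : A ⥤ C`, the restricted Yoneda functor
sends `F.obj a` to the representable presheaf attached to `a`. -/
noncomputable def restrictedULiftYonedaObjObjIso [F.Full] [F.Faithful] (a : A) :
    (Presheaf.restrictedULiftYoneda.{w} F).obj (F.obj a) ≅ yoneda.obj a :=
  NatIso.ofComponents (fun b ↦ (Equiv.ulift.trans
    ((FullyFaithful.ofFullyFaithful F).homEquiv (X := b.unop) (Y := a)).symm).toIso)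
    (fun f ↦ by
      ext ⟨g⟩
      apply F.map_injective
      simp [FullyFaithful.homEquiv, Presheaf.restrictedULiftYoneda]
      rfl)

lemma isCardinalAccessible_restrictedULiftYoneda (κ : Cardinal.{w}) [Fact κ.IsRegular]
    (hF : ∀ a, IsCardinalPresentable (F.obj a) κ) :
    (Presheaf.restrictedULiftYoneda.{w} F).IsCardinalAccessible κ where
  preservesColimitOfShape J _ _ :=
    preservesColimitsOfShape_of_evaluation _ _ (fun a ↦
      Functor.preservesColimitsOfShape_of_isCardinalAccessible
        (uliftCoyoneda.{w}.obj (Opposite.op (F.obj a.unop))) κ J)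

variable {F} {κ : Cardinal.{w}} [Fact κ.IsRegular]

lemma isIndObject_restrictedULiftYoneda_obj [F.Full] [F.Faithful]
    (hF : F.essImage.IsCardinalFilteredGenerator κ) (X : C) :
    IsIndObject ((Presheaf.restrictedULiftYoneda.{w} F).obj X) := by
  obtain ⟨J, _, _, ⟨p⟩⟩ := hF.exists_colimitsOfShape X
  have := isFiltered_of_isCardinalFiltered J κ
  have := F.isCardinalAccessible_restrictedULiftYoneda κ
    (fun a ↦ hF.le_isCardinalPresentable _ (F.obj_mem_essImage a))
  have := (Presheaf.restrictedULiftYoneda.{w}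
    F).preservesColimitsOfShape_of_isCardinalAccessible κ J
  refine ObjectProperty.prop_of_isColimit (IsIndObject (C := A))
    (isColimitOfPreserves (Presheaf.restrictedULiftYoneda.{w} F) p.isColimit) (fun j ↦ ?_)
  obtain ⟨a, ⟨e⟩⟩ := p.prop_diag_obj j
  exact (isIndObject_yoneda a).map ((F.restrictedULiftYonedaObjObjIso a).symm ≪≫
    (Presheaf.restrictedULiftYoneda.{w} F).mapIso e).hom

section

variable [F.Full] [F.Faithful] (hF : F.essImage.IsCardinalFilteredGenerator κ)

/-- The restricted Yoneda functor with values in ind-objects. -/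
noncomputable def toInd : C ⥤ Ind A :=
  ObjectProperty.lift _ (Presheaf.restrictedULiftYoneda.{w} F)
    (isIndObject_restrictedULiftYoneda_obj hF) ⋙ (Ind.equivalence A).inverse

/-- The composition of `toInd` with the inclusion is the restricted Yoneda functor. -/
noncomputable def toIndCompInclusion :
    toInd hF ⋙ Ind.inclusion A ≅ Presheaf.restrictedULiftYoneda.{w} F :=
  isoWhiskerLeft (ObjectProperty.lift _ _ _)
    (isoWhiskerRight (Ind.equivalence A).counitIso (ObjectProperty.ι _))

/-- Density of `F` makes restricted Yoneda fully faithful; the inclusion of `Ind A` into presheaves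
is then cancelled. -/
instance [F.IsDense] : (toInd hF).Full := by
  have := Full.of_iso (toIndCompInclusion hF).symm
  exact Full.of_comp_faithful _ (Ind.inclusion A)

instance [F.IsDense] : (toInd hF).Faithful := by
  have := Faithful.of_iso (toIndCompInclusion hF).symm
  exact Faithful.of_comp _ (Ind.inclusion A)

lemma isCardinalAccessible_toInd : (toInd hF).IsCardinalAccessible κ where
  preservesColimitOfShape J _ _ := by
    have := F.isCardinalAccessible_restrictedULiftYoneda κ
      (fun a ↦ hF.le_isCardinalPresentable _ (F.obj_mem_essImage a))
    have := (Presheaf.restrictedULiftYoneda.{w}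
      F).preservesColimitsOfShape_of_isCardinalAccessible κ J
    have := preservesColimitsOfShape_of_natIso (J := J) (toIndCompInclusion hF).symm
    exact preservesColimitsOfShape_of_reflects_of_preserves _ (Ind.inclusion A)

lemma essImage_toInd_yoneda_obj (a : A) : (toInd hF).essImage (Ind.yoneda.obj a) :=
  ⟨F.obj a, ⟨Ind.inclusion.fullyFaithful.preimageIso
    ((toIndCompInclusion hF).app (F.obj a) ≪≫ F.restrictedULiftYonedaObjObjIso a ≪≫
      (Ind.yonedaCompInclusion.app a).symm)⟩⟩

lemma isRightAdjoint_toInd [F.IsDense] (hC : HasDirectedColimits.{w} C) :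
    (toInd hF).IsRightAdjoint :=
  isRightAdjoint_of_essImage_colimitsOfShape _ (fun Y ↦
    ⟨Y.presentation.I, inferInstance, hC.hasColimitsOfShape _,
      ⟨(ObjectProperty.ColimitOfShape.colimit (Y.presentation.F ⋙ Ind.yoneda)
        (fun _ ↦ essImage_toInd_yoneda_obj hF _)).ofIso
        Y.colimitPresentationCompYoneda⟩⟩)

lemma isAccessiblyEmbedded_essImage_toInd [F.IsDense] [HasCardinalFilteredColimits C κ] :
    IsAccessiblyEmbedded.{w} (toInd hF).essImage :=
  ⟨κ, inferInstance, fun J _ _ ↦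
    have := isCardinalAccessible_toInd hF
    have := (toInd hF).preservesColimitsOfShape_of_isCardinalAccessible κ J
    have := HasCardinalFilteredColimits.hasColimitsOfShape C κ J
    isClosedUnderColimitsOfShape_essImage _ J⟩

end

end Functor

lemma IsCardinalAccessibleCategory.exists_isDense (C : Type u) [Category.{w} C] (κ : Cardinal.{w})
    [Fact κ.IsRegular] [IsCardinalAccessibleCategory C κ] :
    ∃ (A : Type w) (_ : SmallCategory A) (F : A ⥤ C) (_ : F.Full) (_ : F.Faithful) (_ : F.IsDense),
      F.essImage.IsCardinalFilteredGenerator κ := by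
  let e := equivSmallModel.{w} (isCardinalPresentable C κ).FullSubcategory
  refine ⟨_, inferInstance, e.inverse ⋙ (isCardinalPresentable C κ).ι,
    inferInstance, inferInstance, inferInstance, ?_⟩
  rw [Functor.essImage_comp_of_essSurj]
  refine (isCardinalFilteredGenerator_isCardinalPresentable C κ).of_le_isoClosure
    (fun X hX ↦ ObjectProperty.le_isoClosure _ _ ⟨⟨X, hX⟩, ⟨Iso.refl _⟩⟩) ?_
  rintro _ ⟨X, ⟨e⟩⟩
  exact ObjectProperty.prop_of_iso _ e X.property

end CategoryTheory

theorem theorem4p5 :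
    (∀ (C : Type u) [Category.{v} C],
      IsAccessibleCategory.{w} C → HasDirectedColimits.{w} C →
        ∃ (L : Type (w + 1)) (_ : Category.{w} L) (P : ObjectProperty L),
          IsFinitelyAccessibleCategory.{w} L ∧
          Nonempty (Reflective P.ι) ∧
          IsAccessiblyEmbedded.{w} P ∧
          Nonempty (C ≌ P.FullSubcategory)) ∧
    (∀ (L : Type u') [Category.{v'} L] (P : ObjectProperty L),
      IsFinitelyAccessibleCategory.{w} L →
      Nonempty (Reflective P.ι) →
      IsAccessiblyEmbedded.{w} P →
        IsAccessibleCategory.{w} P.FullSubcategory ∧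
        HasDirectedColimits.{w} P.FullSubcategory) := by
  refine ⟨fun C _ hC hC' ↦ ?_, fun L _ P _ ⟨_⟩ hP ↦
    ⟨IsFinitelyAccessibleCategory.isAccessibleCategory_fullSubcategory P hP,
      HasDirectedColimits.of_reflective P.ι
        IsFinitelyAccessibleCategory.hasDirectedColimits⟩⟩
  obtain ⟨κ, _, _⟩ := hC.exists_cardinal
  -- Passing to `D` puts hom-sets in universe `w`, as the embedding into `Ind A` requires.
  obtain ⟨D, _, ⟨e⟩⟩ := HasCardinalFilteredGenerator.exists_equivalence C κ
  have := e.isCardinalAccessibleCategory κ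
  obtain ⟨A, _, F, _, _, _, hF⟩ := IsCardinalAccessibleCategory.exists_isDense D κ
  -- An equivalence is in particular reflective, which transports directed colimits from `C` to `D`.
  let : Reflective e.inverse := { L := _, adj := e.toAdjunction }
  have := Functor.isRightAdjoint_toInd hF (.of_reflective e.inverse hC')
  exact ⟨Ind A, inferInstance, (Functor.toInd hF).essImage, inferInstance,
    Functor.nonempty_reflective_ι_essImage _, Functor.isAccessiblyEmbedded_essImage_toInd hF,
    ⟨e.trans (Functor.toInd hF).toEssImage.asEquivalence⟩⟩
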